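/- Let $G$ be a (possibly infinite) simple graph that is chordal, i.e. has no induced cycle of length four or more. Let $\mathcal H$ be the graph obtained from a countably infinite clique by adding two non-adjacent vertices, each adjacent to every vertex of the clique. Assume that $\mathcal H$ is not an induced minor of $G$, i.e. there is no family $(B_h)_{h\in V(\mathcal H)}$ of pairwise disjoint connected (in particular nonempty) subgraphs of $G$ such that, for all distinct $h,h'\in V(\mathcal H)$, there is an edge of $G$ between $B_h$ and $B_{h'}$ if and only if $hh'\in E(\mathcal H)$. For a set $X$ of vertices write $N(X)$ for the set of vertices outside $X$ that have a neighbour in $X$. Let $A$ be a finite set of vertices that is a clique (pairwise adjacent) in $G$, and let $C$ be a connected component of $G-A$ with $A\subseteq N(C)$. Then for every vertex $v_*$ of $C$ there is a finite clique $B\supseteq A$ of $G$ such that either $v_*\in B$, or the component $D$ of $G-B$ containing $v_*$ satisfies $A\setminus N(D)\neq\emptyset$. -/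

import Mathlib

namespace ChordalExt

/-- A graph is chordal if it has no induced cycle of length four or more. -/
def IsChordal {V : Type*} (G : SimpleGraph V) : Prop :=
  ∀ n : ℕ, 4 ≤ n → ¬ (SimpleGraph.cycleGraph n).IsIndContained G

/-- `H` is an induced minor of `G`: there is a family of disjoint connected subgraphs of `G`
(the branch sets), indexed by the vertices of `H`, such that for distinct `u`, `v` there is an
edge of `G` between the branch sets of `u` and `v` precisely when `uv` is an edge of `H`.
Connected subgraphs are nonempty. -/
def IsInducedMinor {W V : Type*} (H : SimpleGraph W) (G : SimpleGraph V) : Prop :=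
  ∃ B : W → G.Subgraph,
    (∀ w, (B w).Connected) ∧
    (∀ u v, u ≠ v → Disjoint (B u).verts (B v).verts) ∧
    (∀ u v, u ≠ v → (H.Adj u v ↔ ∃ x ∈ (B u).verts, ∃ y ∈ (B v).verts, G.Adj x y))

/-- The graph obtained from a countably infinite clique (the vertices `Sum.inl n`) by adding two
non-adjacent vertices (`Sum.inr false` and `Sum.inr true`) that are adjacent to every vertex of
the clique. -/
def obstructionH : SimpleGraph (ℕ ⊕ Bool) where
  Adj x y := x ≠ y ∧ (x.isLeft = true ∨ y.isLeft = true)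
  symm := ⟨fun _ _ h => ⟨h.1.symm, h.2.symm⟩⟩
  loopless := ⟨fun _ h => h.1 rfl⟩

/-- The neighbourhood `N(X)` of a set `X` of vertices: all vertices outside `X` that have a
neighbour in `X`. -/
def nbhd {V : Type*} (G : SimpleGraph V) (X : Set V) : Set V :=
  {v | v ∉ X ∧ ∃ x ∈ X, G.Adj x v}

/-- A component `C` of `G - S` is attached to `A` (where `A ⊆ S`) if `A ⊆ N(C)`. -/
def IsAttached {V : Type*} {G : SimpleGraph V} {S : Set V} (C : G.ComponentCompl S)
    (A : Set V) : Prop :=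
  A ⊆ nbhd G (C : Set V)

/-- A component `C` of `G - S` is unattached to `A` (where `A ⊆ S`) if `A \ N(C)` is nonempty. -/
def IsUnattached {V : Type*} {G : SimpleGraph V} {S : Set V} (C : G.ComponentCompl S)
    (A : Set V) : Prop :=
  (A \ nbhd G (C : Set V)).Nonempty

/-- The pair `(C, S)`, where `C` is a component of `G - S`, is a side of `G` if `S` is a clique
and `C` is attached to `S`. -/
def IsSide {V : Type*} {G : SimpleGraph V} {S : Set V} (C : G.ComponentCompl S) : Prop :=
  G.IsClique S ∧ IsAttached C S

end ChordalExt

open SimpleGraph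

namespace ChordalExt

variable {V : Type*} {G : SimpleGraph V}

/-! Generalise the vertex to a finite clique `K` and induct on the number of vertices of `A` with a
non-neighbour in `K`. If `a ∈ A` misses `k ∈ K`, let `D` be the component of `k` outside the closed
neighbourhood of `a`. Chordality makes `N(D)` a clique (`adj_of_mem_nbhd`), and the excluded minor
makes it finite (`finite_nbhd`). So induction applies to `N(D)`, and the resulting `B` also serves
`K`, since `K ⊆ D ∪ N(D)`. -/

lemma cycleGraph_adj_of_lt {n : ℕ} {i j : Fin (n + 2)} (hij : i < j) :
    (cycleGraph (n + 2)).Adj i j ↔ (j : ℕ) = i + 1 ∨ ((i : ℕ) = 0 ∧ (j : ℕ) = n + 1) := by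
  have h₁ : ((j - i : Fin (n + 2)) : ℕ) = j - i := Fin.coe_sub_iff_le.mpr hij.le
  have h₂ : ((i - j : Fin (n + 2)) : ℕ) = n + 2 + i - j := Fin.coe_sub_iff_lt.mpr hij
  rw [cycleGraph_adj', h₁, h₂]
  have : (i : ℕ) < j := hij
  omega

/-- A map from a cycle graph that is injective and preserves adjacency on increasing pairs is an
induced embedding. -/
lemma cycleGraph_isIndContained {n : ℕ} (f : Fin (n + 2) → V)
    (hf : ∀ i j, i < j → f i ≠ f j)
    (hadj : ∀ i j, i < j →
      (G.Adj (f i) (f j) ↔ (j : ℕ) = i + 1 ∨ ((i : ℕ) = 0 ∧ (j : ℕ) = n + 1))) :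
    (cycleGraph (n + 2)).IsIndContained G := by
  refine ⟨⟨⟨f, fun i j h ↦ ?_⟩, fun {i j} ↦ ?_⟩⟩
  · by_contra hne
    rcases lt_or_gt_of_ne hne with hlt | hlt
    · exact hf i j hlt h
    · exact hf j i hlt h.symm
  · change G.Adj (f i) (f j) ↔ _
    rcases lt_trichotomy i j with hlt | rfl | hlt
    · rw [hadj i j hlt, cycleGraph_adj_of_lt hlt]
    · simp
    · rw [G.adj_comm, hadj j i hlt, (cycleGraph _).adj_comm, cycleGraph_adj_of_lt hlt]

lemma nbhd_subset {S : Set V} (D : G.ComponentCompl S) : nbhd G (D : Set V) ⊆ S := by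
  rintro v ⟨hv, x, hx, hxv⟩
  by_contra hS
  exact hv (ComponentCompl.mem_of_adj x v hx hS hxv)

/-- The vertex set of a component of `G - S` induces a connected subgraph. -/
lemma connected_induce_componentCompl {S : Set V} (D : G.ComponentCompl S) :
    (G.induce (D : Set V)).Connected := by
  let f : D.toSimpleGraph →g G.induce (D : Set V) :=
    { toFun := fun x ↦ ⟨x.1.1, x.1.2, x.2⟩
      map_rel' := fun {x y} h ↦ h }
  refine (ConnectedComponent.connected_toSimpleGraph D).map f ?_
  rintro ⟨x, hx, hD⟩
  exact ⟨⟨⟨x, hx⟩, hD⟩, rfl⟩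

/-- A connected set that meets `D` but not the neighbourhood of `D` lies in `D`. -/
lemma subset_of_connected_of_disjoint_nbhd {s D : Set V} (hs : (G.induce s).Connected)
    {x : V} (hxs : x ∈ s) (hxD : x ∈ D) (hd : ∀ z ∈ nbhd G D, z ∉ s) : s ⊆ D := by
  intro y hy
  by_contra hyD
  obtain ⟨p⟩ := hs.preconnected ⟨x, hxs⟩ ⟨y, hy⟩
  obtain ⟨d, -, hd₁, hd₂⟩ := p.exists_boundary_dart (Subtype.val ⁻¹' D) hxD hyD
  exact hd d.snd ⟨hd₂, d.fst, hd₁, d.adj⟩ d.snd.2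

/-- In a chordal graph, two vertices in the neighbourhood of a connected set are adjacent if they
have a common neighbour that neither lies in the set nor has a neighbour in it. -/
lemma adj_of_mem_nbhd (hG : IsChordal G) {D : Set V} (hD : (G.induce D).Connected) {a x y : V}
    (haD : ∀ z ∈ D, ¬ G.Adj a z) (haD' : a ∉ D) (hx : x ∈ nbhd G D) (hy : y ∈ nbhd G D)
    (hax : G.Adj a x) (hay : G.Adj a y) (hxy : x ≠ y) : G.Adj x y := by
  by_contra hnadj
  obtain ⟨hxD, x', hx', hxx'⟩ := hx
  obtain ⟨hyD, y', hy', hyy'⟩ := hy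
  have hc₁ : (G.induce (D ∪ {x})).Connected :=
    connected_induce_union hD.preconnected (w := x) (by simp) hx' rfl hxx'
  have hc : (G.induce (D ∪ {x} ∪ {y})).Connected :=
    connected_induce_union hc₁.preconnected (w := y) (by simp) (Or.inl hy') rfl hyy'
  set s : Set V := D ∪ {x} ∪ {y} with hs
  have hxs : x ∈ s := Or.inl (Or.inr rfl)
  have hys : y ∈ s := Or.inr rfl
  -- A shortest path is induced, and its interior lies in `D`, where `a` has no neighbour; so `a`
  -- closes it to an induced cycle.
  obtain ⟨p, hp⟩ := hc.exists_walk_length_eq_dist ⟨x, hxs⟩ ⟨y, hys⟩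
  have hdist : ∀ i ≤ p.length, (G.induce s).dist ⟨x, hxs⟩ (p.getVert i) = i := by
    intro i hi
    have h₁ := length_eq_dist_of_subwalk hp (p.isSubwalk_take i)
    rw [← h₁, Walk.take_length]
    omega
  have hinj : ∀ i ≤ p.length, ∀ j ≤ p.length, p.getVert i = p.getVert j → i = j := by
    intro i hi j hj h
    rw [← hdist i hi, h, hdist j hj]
  have hadj : ∀ i j, i < j → j ≤ p.length →
      (G.Adj (p.getVert i).1 (p.getVert j).1 ↔ j = i + 1) := by
    intro i j hij hj
    constructor
    · intro h
      have h' : (G.induce s).Adj (p.getVert i) (p.getVert j) := h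
      have := h'.diff_dist_adj (u := ⟨x, hxs⟩)
      rw [hdist i (hij.le.trans hj), hdist j hj] at this
      omega
    · rintro rfl
      exact p.adj_getVert_succ hj
  have hlen : 2 ≤ p.length := by
    by_contra! hlt
    have h0 : (p.getVert 0).1 = x := by simp
    have hl : (p.getVert p.length).1 = y := by simp
    interval_cases hn : p.length
    · exact hxy (h0.symm.trans hl)
    · have h := (hadj 0 1 one_pos le_rfl).2 rfl
      rw [h0, hl] at h
      exact hnadj h
  have hinner : ∀ i ≤ p.length, (G.Adj (p.getVert i).1 a ↔ i = 0 ∨ i = p.length) := by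
    intro i hi
    constructor
    · intro h
      by_contra! hne
      rcases (p.getVert i).2 with (h' | h') | h'
      · exact haD _ h' h.symm
      · exact hne.1 (hinj i hi 0 (Nat.zero_le _) (Subtype.ext (by simpa using h')))
      · exact hne.2 (hinj i hi _ le_rfl (Subtype.ext (by simpa using h')))
    · rintro (rfl | rfl)
      · simpa using hax.symm
      · simpa using hay.symm
  have hane : ∀ i, (p.getVert i).1 ≠ a := by
    intro i h
    rcases (p.getVert i).2 with (h' | h') | h'
    · exact haD' (h ▸ h')
    · exact hax.ne (h.symm.trans h')
    · exact hay.ne (h.symm.trans h')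
  -- The path has `p.length + 1` vertices; the one remaining index goes to `a`.
  refine hG (p.length + 2) (by omega) (cycleGraph_isIndContained
    (fun i ↦ if (i : ℕ) ≤ p.length then (p.getVert i).1 else a) ?_ ?_)
  · intro i j hij
    have hij' : (i : ℕ) < j := hij
    have hj := j.2
    have hi : (i : ℕ) ≤ p.length := by omega
    by_cases hjl : (j : ℕ) ≤ p.length
    · simp only [hi, hjl, if_true]
      exact fun h ↦ hij'.ne (hinj _ hi _ hjl (Subtype.ext h))
    · simpa only [hi, hjl, if_true, if_false] using hane i
  · intro i j hij
    have hij' : (i : ℕ) < j := hij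
    have hj := j.2
    have hi : (i : ℕ) ≤ p.length := by omega
    by_cases hjl : (j : ℕ) ≤ p.length
    · simp only [hi, hjl, if_true]
      rw [hadj i j hij' hjl]
      omega
    · simp only [hi, hjl, if_true, if_false]
      rw [hinner i hi]
      omega

/-- If the neighbourhood of a connected set `D` is a clique all of whose vertices are adjacent to
a vertex `a` outside `D` with no neighbour in `D`, then it is finite unless the obstruction is an
induced minor. -/
lemma finite_nbhd (hH : ¬ IsInducedMinor obstructionH G) {D : Set V}
    (hD : (G.induce D).Connected) {a : V} (haD : ∀ z ∈ D, ¬ G.Adj a z) (haD' : a ∉ D)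
    (hN : nbhd G D ⊆ G.neighborSet a) (hclique : G.IsClique (nbhd G D)) :
    (nbhd G D).Finite := by
  by_contra hinf
  let f := Set.Infinite.natEmbedding _ hinf
  have hf : ∀ m n, m ≠ n → (f m : V) ≠ f n := fun m n h h' ↦ h (f.injective (Subtype.ext h'))
  have hfa : ∀ n, G.Adj a (f n) := fun n ↦ hN (f n).2
  -- Vertices of `N(D)` form the infinite clique; `{a}` and `D` are the two non-adjacent branch
  -- sets.
  refine hH ⟨Sum.elim (fun n ↦ G.singletonSubgraph (f n))
    (fun b ↦ if b then (⊤ : G.Subgraph).induce D else G.singletonSubgraph a), ?_, ?_, ?_⟩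
  · rintro (n | _ | _)
    · exact Subgraph.singletonSubgraph_connected
    · exact Subgraph.singletonSubgraph_connected
    · exact connected_induce_iff.1 hD
  · rintro (m | _ | _) (n | _ | _) hne
    · simpa using hf m n (by simpa using hne)
    · simpa using (hfa m).ne'
    · simpa using (f m).2.1
    · simpa using (hfa n).ne
    · simp at hne
    · simpa using haD'
    · simpa using (f n).2.1
    · simpa using haD'
    · simp at hne
  · rintro (m | _ | _) (n | _ | _) hne
    · have h := hclique (f m).2 (f n).2 (hf m n (by simpa using hne))
      simpa [obstructionH, h] using hne
    · simpa [obstructionH] using (hfa m).symm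
    · obtain ⟨z, hz, hzm⟩ := (f m).2.2
      simpa [obstructionH] using ⟨z, hz, hzm.symm⟩
    · simpa [obstructionH] using hfa n
    · simp at hne
    · simpa [obstructionH] using haD
    · obtain ⟨z, hz, hzn⟩ := (f n).2.2
      simpa [obstructionH] using ⟨z, hz, hzn⟩
    · simpa [obstructionH, G.adj_comm] using haD
    · simp at hne

/-- In a chordal graph without the obstruction, the component of a vertex in the complement of a
closed neighbourhood has a finite clique as its neighbourhood. -/
lemma nbhd_component_compl_closedNbhd (hG : IsChordal G) (hH : ¬ IsInducedMinor obstructionH G)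
    {a : V} (D : G.ComponentCompl (insert a (G.neighborSet a))) :
    nbhd G (D : Set V) ⊆ G.neighborSet a ∧ G.IsClique (nbhd G (D : Set V)) ∧
      (nbhd G (D : Set V)).Finite := by
  have hS : ∀ z ∈ (D : Set V), z ∉ insert a (G.neighborSet a) :=
    fun z hz ↦ ComponentCompl.notMem_of_mem hz
  have haD : ∀ z ∈ (D : Set V), ¬ G.Adj a z := fun z hz h ↦ hS z hz (Or.inr h)
  have haD' : a ∉ (D : Set V) := fun h ↦ hS a h (Or.inl rfl)
  have hN : nbhd G (D : Set V) ⊆ G.neighborSet a := by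
    intro x hx
    rcases nbhd_subset D hx with rfl | h
    · obtain ⟨-, z, hz, hzx⟩ := hx
      exact (haD z hz hzx.symm).elim
    · exact h
  have hD := connected_induce_componentCompl D
  have hclique : G.IsClique (nbhd G (D : Set V)) := fun x hx y hy hxy ↦
    adj_of_mem_nbhd hG hD haD haD' hx hy (hN hx) (hN hy) hxy
  exact ⟨hN, hclique, finite_nbhd hH hD haD haD' hN hclique⟩

/-- In a chordal graph without the obstruction, a finite clique `A` extends to a finite clique `B`
that contains a given finite clique `K`, or separates the rest of `K` from some vertex of `A`. -/
theorem exists_finite_clique_extension (hG : IsChordal G)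
    (hH : ¬ IsInducedMinor obstructionH G) {A : Set V} (hA : A.Finite) (hAc : G.IsClique A) :
    ∀ K : Set V, K.Finite → G.IsClique K →
      ∃ B : Set V, B.Finite ∧ G.IsClique B ∧ A ⊆ B ∧
        (K ⊆ B ∨ ∃ D : G.ComponentCompl B, K \ B ⊆ D ∧ IsUnattached D A) := by
  let bad (K : Set V) : Set V := {a ∈ A | ∃ k ∈ K, k ≠ a ∧ ¬ G.Adj k a}
  have hbad : ∀ K, (bad K).Finite := fun K ↦ hA.subset fun _ h ↦ h.1
  suffices H : ∀ n : ℕ, ∀ K : Set V, (bad K).ncard = n → K.Finite → G.IsClique K →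
      ∃ B : Set V, B.Finite ∧ G.IsClique B ∧ A ⊆ B ∧
        (K ⊆ B ∨ ∃ D : G.ComponentCompl B, K \ B ⊆ D ∧ IsUnattached D A) from
    fun K ↦ H _ K rfl
  intro n
  induction n using Nat.strong_induction_on with
  | _ n ih =>
  rintro K rfl hK hKc
  by_cases hempty : bad K = ∅
  · refine ⟨A ∪ K, hA.union hK, ?_, Set.subset_union_left, Or.inl Set.subset_union_right⟩
    have hAK : ∀ a ∈ A, ∀ k ∈ K, k ≠ a → G.Adj k a := by
      intro a ha k hk hne
      by_contra hadj
      exact (Set.eq_empty_iff_forall_notMem.1 hempty) a ⟨ha, k, hk, hne, hadj⟩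
    rintro x (hx | hx) y (hy | hy) hxy
    · exact hAc hx hy hxy
    · exact (hAK x hx y hy hxy.symm).symm
    · exact hAK y hy x hx hxy
    · exact hKc hx hy hxy
  obtain ⟨a, ha, k, hk, hka, hnadj⟩ := Set.nonempty_iff_ne_empty.2 hempty
  have hkS : k ∉ insert a (G.neighborSet a) := by
    rintro (h | h)
    · exact hka h
    · exact hnadj h.symm
  let D := G.componentComplMk hkS
  have hkD : k ∈ (D : Set V) := G.componentComplMk_mem hkS
  obtain ⟨hN, hNc, hNf⟩ := nbhd_component_compl_closedNbhd hG hH D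
  have hAD : ∀ z ∈ A, z ∉ (D : Set V) := by
    intro z hz hzD
    refine ComponentCompl.notMem_of_mem hzD ?_
    by_cases hza : z = a
    · exact Or.inl hza
    · exact Or.inr (hAc ha hz (Ne.symm hza))
  have hKD : ∀ z ∈ K, z ∉ (D : Set V) → z ∈ nbhd G (D : Set V) := fun z hz hzD ↦
    ⟨hzD, k, hkD, hKc hk hz (by rintro rfl; exact hzD hkD)⟩
  -- `a` is complete to `N(D)`, so it stops being bad. A vertex of `A` adjacent to `k` lies in the
  -- clique `N(D)`, so it cannot become bad.
  have hsub : bad (nbhd G (D : Set V)) ⊂ bad K := by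
    refine (Set.ssubset_iff_of_subset ?_).2 ⟨a, ⟨ha, k, hk, hka, hnadj⟩, ?_⟩
    · rintro b ⟨hb, z, hz, hzb, hzadj⟩
      have hbD : b ∉ (D : Set V) := hAD b hb
      refine ⟨hb, k, hk, by rintro rfl; exact hbD hkD, fun h ↦ hzadj ?_⟩
      exact hNc hz ⟨hbD, k, hkD, h⟩ hzb
    · rintro ⟨-, z, hz, -, hzadj⟩
      exact hzadj (hN hz).symm
  obtain ⟨B, hBf, hBc, hAB, hB⟩ :=
    ih _ (Set.ncard_lt_ncard hsub (hbad K)) _ rfl hNf hNc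
  refine ⟨B, hBf, hBc, hAB, ?_⟩
  -- The clique `B` contains `a`, so it lies in the closed neighbourhood of `a`, which `D` avoids.
  have hBD : ∀ z ∈ (D : Set V), z ∉ B := by
    intro z hzD hzB
    refine ComponentCompl.notMem_of_mem hzD ?_
    by_cases hza : z = a
    · exact Or.inl hza
    · exact Or.inr (hBc (hAB ha) hzB (Ne.symm hza))
  have hDle : ∀ (E : G.ComponentCompl B) (x : V), x ∈ (D : Set V) → x ∈ (E : Set V) →
      (D : Set V) ⊆ E := fun E x hxD hxE ↦
    subset_of_connected_of_disjoint_nbhd (connected_induce_componentCompl D) hxD hxE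
      fun z hz hzD ↦ hBD z hzD (nbhd_subset E hz)
  refine Or.inr ?_
  -- If `N(D) ⊆ B`, then `D` is itself a component of `G - B`, and it has no neighbour of `a`.
  -- Otherwise the component containing `N(D) \ B` absorbs `D`, hence also `K \ B`.
  by_cases hNB : nbhd G (D : Set V) ⊆ B
  · let E := G.componentComplMk (hBD k hkD)
    have hkE : k ∈ (E : Set V) := G.componentComplMk_mem _
    refine ⟨E, fun z hz ↦ ?_, a, ha, ?_⟩
    · by_contra hzE
      exact hz.2 (hNB (hKD z hz.1 fun h ↦ hzE (hDle E k hkD hkE h)))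
    · rintro ⟨-, z, hz, hza⟩
      have hED : (E : Set V) ⊆ D :=
        subset_of_connected_of_disjoint_nbhd (connected_induce_componentCompl E) hkE hkD
          fun w hw hwE ↦ ComponentCompl.notMem_of_mem hwE (hNB hw)
      exact ComponentCompl.notMem_of_mem (hED hz) (Or.inr hza.symm)
  · obtain ⟨E, hE, hEA⟩ := hB.resolve_left hNB
    obtain ⟨x, hx, hxB⟩ := Set.not_subset.1 hNB
    obtain ⟨-, y, hyD, hyx⟩ := id hx
    have hyE : y ∈ (E : Set V) :=
      ComponentCompl.mem_of_adj x y (hE ⟨hx, hxB⟩) (hBD y hyD) hyx.symm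
    refine ⟨E, fun z hz ↦ ?_, hEA⟩
    by_cases hzD : z ∈ (D : Set V)
    · exact hDle E y hyD hyE hzD
    · exact hE ⟨hKD z hz.1 hzD, hz.2⟩

end ChordalExt

theorem lemma3p7 {V : Type*} (G : SimpleGraph V) (hG : ChordalExt.IsChordal G)
    (hH : ¬ ChordalExt.IsInducedMinor ChordalExt.obstructionH G)
    (A : Set V) (C : G.ComponentCompl A) (hside : ChordalExt.IsSide C) (hA : A.Finite)
    (v : V) (hv : v ∈ C) :
    ∃ B : Set V, B.Finite ∧ G.IsClique B ∧ A ⊆ B ∧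
      (v ∈ B ∨ ∃ D : G.ComponentCompl B, v ∈ D ∧ ChordalExt.IsUnattached D A) := by
  obtain ⟨B, hBf, hBc, hAB, hB⟩ := ChordalExt.exists_finite_clique_extension hG hH hA hside.1
    {v} (Set.finite_singleton v) (by simp)
  refine ⟨B, hBf, hBc, hAB, ?_⟩
  by_cases hvB : v ∈ B
  · exact Or.inl hvB
  · rcases hB with h | ⟨D, hD, hDA⟩
    · exact Or.inl (h rfl)
    · exact Or.inr ⟨D, hD ⟨rfl, hvB⟩, hDA⟩
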